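/- Let $B=(B(t))_{0\le t\le 1}$ be a standard Brownian bridge, i.e. a centered Gaussian process with almost surely continuous paths and covariance $\operatorname{Cov}(B(s),B(t))=\min(s,t)-st$, and let $$V=\frac{1}{\frac{\pi^2}{3}-2}\left\{\int_0^1\frac{6B^2(t)}{t(1-t)}\,dt-\left[\int_0^1 6B(t)\,dt\right]^2\right\}-\left[\frac{1}{\frac{\pi^2}{3}-2}\int_0^1 6B(t)\ln\left(\frac{t}{1-t}\right)dt\right]^2,$$ where the integrals exist with probability one. Let $(Z_m)_{m\ge 1}$ be a sequence of independent standard normal random variables. Then the two series below converge with probability one, and $$V\ \overset{\mathcal D}{=}\ \frac{1}{\frac{\pi^2}{3}-2}\sum_{k=2}^\infty\frac{6}{k(k+1)}Z_k^2-\left[\frac{1}{\frac{\pi^2}{3}-2}\sum_{l=1}^\infty\frac{3\sqrt{4l+1}}{l(l+1)(2l-1)(2l+1)}Z_{2l}\right]^2 .$$ -/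

import Mathlib

open MeasureTheory ProbabilityTheory

/-- A (standard) Brownian bridge on `[0,1]`: a centered Gaussian process with covariance function
`min s t - s t` and almost surely continuous paths. -/
structure IsBrownianBridge {Ω : Type*} [MeasurableSpace Ω]
    (B : unitInterval → Ω → ℝ) (P : Measure Ω) : Prop where
  isGaussianProcess : IsGaussianProcess B P
  integral_eq_zero : ∀ t, ∫ ω, B t ω ∂P = 0
  covariance_eq : ∀ s t, cov[B s, B t; P] = min (s : ℝ) (t : ℝ) - (s : ℝ) * (t : ℝ)
  continuous_paths : ∀ᵐ ω ∂P, Continuous (fun t => B t ω)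

/-- The random variable
`V = (π²/3 - 2)⁻¹ { ∫₀¹ 6 B(t)² / (t (1 - t)) dt - [∫₀¹ 6 B(t) dt]² }
  - [(π²/3 - 2)⁻¹ ∫₀¹ 6 B(t) ln (t / (1 - t)) dt]²`. -/
noncomputable def limitV {Ω : Type*} (B : unitInterval → Ω → ℝ) (ω : Ω) : ℝ :=
  1 / (Real.pi ^ 2 / 3 - 2) *
      ((∫ t : unitInterval, 6 * B t ω ^ 2 / ((t : ℝ) * (1 - (t : ℝ))))
        - (∫ t : unitInterval, 6 * B t ω) ^ 2)
    - (1 / (Real.pi ^ 2 / 3 - 2) *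
        ∫ t : unitInterval, 6 * B t ω * Real.log ((t : ℝ) / (1 - (t : ℝ)))) ^ 2

/-- The `k`-th term (`k = 1, 2, …`) of the quadratic series, whose summation index is shifted so
that it starts at `1`: it is `6 / (m (m + 1)) * Z_m²` with `m = k + 1 ≥ 2`. -/
noncomputable def quadraticTerm {Ω : Type*} (Z : ℕ+ → Ω → ℝ) (k : ℕ+) (ω : Ω) : ℝ :=
  6 / (((k : ℝ) + 1) * ((k : ℝ) + 2)) * Z (k + 1) ω ^ 2

/-- The `l`-th term (`l = 1, 2, …`) of the linear series,
`3 √(4 l + 1) / (l (l + 1) (2 l - 1) (2 l + 1)) * Z_{2 l}`. -/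
noncomputable def linearTerm {Ω : Type*} (Z : ℕ+ → Ω → ℝ) (l : ℕ+) (ω : Ω) : ℝ :=
  3 * √(4 * (l : ℝ) + 1) / ((l : ℝ) * ((l : ℝ) + 1) * (2 * (l : ℝ) - 1) * (2 * (l : ℝ) + 1))
    * Z (2 * l) ω

/-! Write `w(t) = t(1-t)` and `P_k` for the shifted Legendre polynomials. The Legendre equation `(w
P_k')' = -k(k+1) P_k` is used in two ways.

Analytically, integration by parts makes the derivatives `P_k'`, `k ≥ 1`, orthogonal in `L²(w dt)`,
with squared norm `k(k+1)/(2k+1)`; they are complete because polynomials are dense. For a path `b`,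
put `c_k = √(2k+1) ∫ b P_k'` (`legendreCoeff`). Parseval applied to `b/w` gives `∫ b²/w = ∑
c_k²/(k(k+1))` (`hasSum_sq_div_weight`). Parseval between `b/w` and `log(t/(1-t))` gives the linear
series (`hasSum_mul_logit`), in which only even indices survive because the logit is antisymmetric
about `1/2`. Since `P_1' = -2`, the term `(∫ 6b)²` is `3c_1²`, exactly the `k = 1` term of the
quadratic series, which explains why that series starts at `2`.

Probabilistically, the bridge covariance is the Green function of `-u''` with zero boundary values.
As `u = w P_k'` vanishes at both ends and `u'' = -k(k+1) P_k'`, the covariance operator sends `P_k'`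
to `w P_k'/(k(k+1))`. Orthogonality then makes the `c_k` of the bridge independent standard normals
(`map_fun_legendreCoeff`). Hence `V` is almost surely a fixed function of a white noise sequence,
and replacing that sequence by `Z` preserves the law. -/

/-! ### Shifted Legendre polynomials and their differential equation -/

open Polynomial in
/-- The shifted Legendre polynomials with real coefficients. -/
noncomputable def realLegendre (k : ℕ) : Polynomial ℝ :=
  (shiftedLegendre k).map (Int.castRingHom ℝ)

namespace realLegendre

open Polynomial

lemma coeff_eq (n k : ℕ) :
    (realLegendre n).coeff k = (-1) ^ k * n.choose k * (n + k).choose n := by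
  simp [realLegendre, coeff_shiftedLegendre]

lemma degree_eq (n : ℕ) : (realLegendre n).degree = n := by
  rw [realLegendre, degree_map_eq_of_injective (RingHom.injective_int _), degree_shiftedLegendre]

lemma natDegree_eq (n : ℕ) : (realLegendre n).natDegree = n :=
  natDegree_eq_of_degree_eq_some (degree_eq n)

lemma eval_zero (n : ℕ) : (realLegendre n).eval 0 = 1 := by
  rw [← coeff_zero_eq_eval_zero, coeff_eq]; simp

lemma eval_one_sub (n : ℕ) (x : ℝ) :
    (realLegendre n).eval (1 - x) = (-1) ^ n * (realLegendre n).eval x := by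
  have := shiftedLegendre_eval_symm n (1 - x)
  simpa [realLegendre, eval_map_algebraMap, ← eval_map_algebraMap] using this

lemma eval_one (n : ℕ) : (realLegendre n).eval 1 = (-1) ^ n := by
  simpa [eval_zero] using eval_one_sub n 0

/-- The weight `X (1 - X)` as a polynomial. -/
noncomputable def weight : Polynomial ℝ := X - X ^ 2

/-- The Legendre equation read off coefficientwise; it comes from the ratios of consecutive binomial
coefficients. -/
lemma coeff_recurrence (n k : ℕ) :
    ((k : ℝ) + 1) ^ 2 * (realLegendre n).coeff (k + 1)
      = (k * (k + 1) - n * (n + 1)) * (realLegendre n).coeff k := by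
  rw [coeff_eq, coeff_eq]
  have h1 : (n.choose (k + 1) : ℝ) * (k + 1) = n.choose k * (n - k) := by
    rcases le_or_gt k n with h | h
    · have := Nat.choose_succ_right_eq n k
      rw [← Nat.cast_sub h]
      exact_mod_cast this
    · simp [Nat.choose_eq_zero_of_lt h, Nat.choose_eq_zero_of_lt (h.trans (Nat.lt_succ_self k))]
  have h2 : ((n + (k + 1)).choose n : ℝ) * (k + 1) = (n + k).choose n * (n + k + 1) := by
    have := Nat.choose_mul_succ_eq (n + k) n
    have e : n + k + 1 - n = k + 1 := by omega
    rw [e] at this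
    rw [← add_assoc]
    exact_mod_cast this.symm
  have : ((k : ℝ) + 1) ^ 2 * ((-1) ^ (k + 1) * n.choose (k + 1) * (n + (k + 1)).choose n)
      = (-1) ^ (k + 1) * ((n.choose (k + 1) : ℝ) * (k + 1))
        * (((n + (k + 1)).choose n : ℝ) * (k + 1)) := by ring
  rw [this, h1, h2]
  ring

/-- The Legendre differential equation. -/
lemma derivative_weight_mul_derivative (n : ℕ) :
    derivative (weight * derivative (realLegendre n))
      = C (-((n : ℝ) * (n + 1))) * realLegendre n := by
  ext k
  rw [coeff_C_mul, coeff_derivative, weight, sub_mul, coeff_sub, coeff_X_mul, coeff_derivative]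
  have h : (X ^ 2 * derivative (realLegendre n)).coeff (k + 1)
      = (realLegendre n).coeff k * k := by
    rcases k with _ | k
    · simp [coeff_X_pow_mul']
    · rw [show k + 1 + 1 = k + 2 from rfl, coeff_X_pow_mul, coeff_derivative]
      push_cast; ring
  rw [h]
  linear_combination coeff_recurrence n k

end realLegendre

/-! ### Integration of polynomials over the unit interval -/

open Polynomial in
/-- Fundamental theorem of calculus for polynomials on `[0, 1]`. -/
lemma integral_eval_derivative (p : Polynomial ℝ) (a b : ℝ) :
    ∫ x in a..b, (derivative p).eval x = p.eval b - p.eval a :=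
  intervalIntegral.integral_eq_sub_of_hasDerivAt (fun x _ => p.hasDerivAt x)
    (p.derivative.continuous.intervalIntegrable _ _)

lemma intervalIntegrable_eval (p : Polynomial ℝ) (a b : ℝ) :
    IntervalIntegrable (fun x => p.eval x) volume a b :=
  p.continuous.intervalIntegrable _ _

/-- Integration over `[0, 1]` as a linear functional on polynomials. -/
noncomputable def polyIntegral : Polynomial ℝ →ₗ[ℝ] ℝ where
  toFun p := ∫ x in (0 : ℝ)..1, p.eval x
  map_add' p q := by
    simp only [Polynomial.eval_add]
    exact intervalIntegral.integral_add (intervalIntegrable_eval p 0 1)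
      (intervalIntegrable_eval q 0 1)
  map_smul' c p := by simp

lemma polyIntegral_apply (p : Polynomial ℝ) : polyIntegral p = ∫ x in (0 : ℝ)..1, p.eval x := rfl

lemma polyIntegral_derivative (p : Polynomial ℝ) :
    polyIntegral p.derivative = p.eval 1 - p.eval 0 := integral_eval_derivative p 0 1

lemma polyIntegral_C_mul (c : ℝ) (p : Polynomial ℝ) :
    polyIntegral (Polynomial.C c * p) = c * polyIntegral p := by
  rw [← Polynomial.smul_eq_C_mul, map_smul, smul_eq_mul]

/-! ### Orthogonality of the Legendre polynomials and of their derivatives -/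

namespace realLegendre

open Polynomial

lemma eval_weight (x : ℝ) : weight.eval x = x * (1 - x) := by simp [weight]; ring

/-- Integration by parts: the boundary terms vanish with the weight, and the Legendre equation
evaluates the remaining derivative. Orthogonality thus passes from `P_n` to `P_n'`. -/
lemma polyIntegral_weight_mul_derivative_mul (n : ℕ) (q : ℝ[X]) :
    polyIntegral (weight * (derivative (realLegendre n) * derivative q))
      = n * (n + 1) * polyIntegral (realLegendre n * q) := by
  have h := polyIntegral_derivative (weight * derivative (realLegendre n) * q)
  rw [derivative_mul, derivative_weight_mul_derivative, map_add, mul_assoc, polyIntegral_C_mul] at h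
  simp only [eval_mul, eval_weight] at h
  rw [← mul_assoc]
  linear_combination h

/-- Sturm–Liouville argument: the weighted integral of `P_n' P_m'` is symmetric, while the
eigenvalues `n(n+1)` and `m(m+1)` differ. -/
lemma polyIntegral_mul_of_ne {n m : ℕ} (h : n ≠ m) :
    polyIntegral (realLegendre n * realLegendre m) = 0 := by
  have h1 := polyIntegral_weight_mul_derivative_mul n (realLegendre m)
  have h2 := polyIntegral_weight_mul_derivative_mul m (realLegendre n)
  rw [mul_comm (derivative _) (derivative _), h1, mul_comm (realLegendre m)] at h2
  have h3 : ((n : ℝ) - m) * (n + m + 1) * polyIntegral (realLegendre n * realLegendre m) = 0 := by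
    linear_combination h2
  have h4 : ((n : ℝ) - m) ≠ 0 := sub_ne_zero.2 (by exact_mod_cast h)
  have h5 : ((n : ℝ) + m + 1) ≠ 0 := by positivity
  simpa [h4, h5] using h3

/-- The shifted Legendre polynomials as a polynomial sequence. -/
noncomputable def sequence : Polynomial.Sequence ℝ where
  elems' := realLegendre
  degree_eq' := degree_eq

lemma polyIntegral_mul_of_degree_lt {n : ℕ} {q : ℝ[X]} (hq : q.degree < n) :
    polyIntegral (realLegendre n * q) = 0 := by
  have hq' : q ∈ Submodule.span ℝ (sequence '' Set.Iio n) := by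
    rw [sequence.span_degreeLT (fun i _ => isUnit_iff_ne_zero.2 (by simp))]
    exact mem_degreeLT.2 hq
  clear hq
  induction hq' using Submodule.span_induction with
  | mem x hx =>
    obtain ⟨m, hm, rfl⟩ := hx
    exact polyIntegral_mul_of_ne (ne_of_gt hm)
  | zero => simp
  | add x y _ _ hx hy => rw [mul_add, map_add, hx, hy, add_zero]
  | smul c x _ hx => rw [mul_smul_comm, map_smul, hx, smul_zero]

lemma polyIntegral_sq (n : ℕ) :
    polyIntegral (realLegendre n * realLegendre n) = 1 / (2 * n + 1) := by
  set P := realLegendre n with hP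
  have h := polyIntegral_derivative ((2 * X - 1) * (P * P))
  -- The leading terms of `(2X - 1)P'` and `2nP` cancel, so the second factor has degree below `n`
  -- and is orthogonal to `P`. Integrating the derivative of `(2X - 1)P²` then leaves `(4n + 2)∫P² =
  -- 2`.
  have hr : polyIntegral (P * ((2 * X - 1) * derivative P - C (2 * n : ℝ) * P)) = 0 := by
    apply polyIntegral_mul_of_degree_lt
    rw [degree_lt_iff_coeff_zero]
    intro m hm
    rw [coeff_sub, coeff_C_mul, sub_mul, coeff_sub, one_mul, mul_assoc]
    rcases hm.eq_or_lt with rfl | hm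
    · rcases n with _ | n
      · simp [coeff_derivative, hP, coeff_eq]
      · rw [show (2 : ℝ[X]) = C 2 from rfl, coeff_C_mul, coeff_X_mul, coeff_derivative,
          coeff_derivative, coeff_eq_zero_of_natDegree_lt (n := n + 1 + 1) (by simp [hP, natDegree_eq])]
        push_cast; ring
    · obtain ⟨m, rfl⟩ : ∃ k, m = k + 1 := ⟨m - 1, by omega⟩
      rw [show (2 : ℝ[X]) = C 2 from rfl, coeff_C_mul, coeff_X_mul, coeff_derivative,
          coeff_derivative, coeff_eq_zero_of_natDegree_lt (n := m + 1) (by simp [hP, natDegree_eq]; omega),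
          coeff_eq_zero_of_natDegree_lt (n := m + 1 + 1) (by simp [hP, natDegree_eq]; omega)]
      simp
  have e1 : derivative ((2 * X - 1) * (P * P))
      = C 2 * (P * P) + C 2 * (P * ((2 * X - 1) * derivative P - C (2 * n : ℝ) * P))
        + C (4 * n : ℝ) * (P * P) := by
    have e2 : derivative (2 * X - 1 : ℝ[X]) = C 2 := by
      rw [show (2 : ℝ[X]) = C 2 from rfl]; simp
    have e3 : (C (4 * n : ℝ) : ℝ[X]) = C 2 * C (2 * n : ℝ) := by rw [← C_mul]; ring_nf
    rw [derivative_mul, derivative_mul, e2, e3, show (C 2 : ℝ[X]) = 2 from rfl]; ring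
  rw [e1, map_add, map_add, polyIntegral_C_mul, polyIntegral_C_mul, polyIntegral_C_mul, hr] at h
  simp only [eval_mul, eval_sub, eval_X, eval_ofNat, Polynomial.eval_one, hP, eval_zero,
    realLegendre.eval_one] at h
  have h1 : ((-1 : ℝ) ^ n) * (-1) ^ n = 1 := by rw [← mul_pow]; simp
  rw [← hP] at h
  rw [eq_div_iff (by positivity)]
  linear_combination h / 2 + h1 / 2

lemma polyIntegral_weight_mul_derivative_sq (n : ℕ) :
    polyIntegral (weight * (derivative (realLegendre n) * derivative (realLegendre n)))
      = n * (n + 1) / (2 * n + 1) := by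
  rw [polyIntegral_weight_mul_derivative_mul, polyIntegral_sq]; ring

lemma polyIntegral_weight_mul_derivative_of_ne {n m : ℕ} (h : n ≠ m) :
    polyIntegral (weight * (derivative (realLegendre n) * derivative (realLegendre m))) = 0 := by
  rw [polyIntegral_weight_mul_derivative_mul, polyIntegral_mul_of_ne h, mul_zero]

lemma polyIntegral_linear_mul_derivative {n : ℕ} (hn : n ≠ 0) :
    polyIntegral ((2 * X - 1) * derivative (realLegendre n)) = 1 + (-1) ^ n := by
  have h := polyIntegral_derivative ((2 * X - 1) * realLegendre n)
  have h0 : polyIntegral (realLegendre n) = 0 := by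
    have := polyIntegral_mul_of_degree_lt (n := n) (q := 1)
      (by rw [degree_one]; exact_mod_cast Nat.pos_of_ne_zero hn)
    simpa using this
  have e2 : derivative (2 * X - 1 : ℝ[X]) = C 2 := by
    rw [show (2 : ℝ[X]) = C 2 from rfl]; simp
  rw [derivative_mul, map_add, e2, polyIntegral_C_mul, h0] at h
  simp only [eval_mul, eval_sub, eval_X, eval_ofNat, Polynomial.eval_one, eval_zero,
    realLegendre.eval_one] at h
  linear_combination h

end realLegendre

/-! ### The logit function and its moments against `P_n'` -/

lemma integral_unitInterval_eq (f : ℝ → ℝ) :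
    ∫ t : unitInterval, f t = ∫ x in (0 : ℝ)..1, f x := by
  rw [intervalIntegral.integral_of_le zero_le_one, ← integral_Icc_eq_integral_Ioc]
  exact integral_subtype measurableSet_Icc f

lemma integrable_unitInterval_iff {f : ℝ → ℝ} :
    Integrable (fun t : unitInterval => f t) ↔ IntervalIntegrable f volume 0 1 := by
  rw [intervalIntegrable_iff_integrableOn_Icc_of_le zero_le_one]
  have := unitInterval.measurePreserving_coe.integrable_comp_emb
    unitInterval.measurableEmbedding_coe (g := f)
  exact this

/-- The function `t (1 - t) log (t / (1 - t))`, extended continuously by `0`. -/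
noncomputable def weightLogit (t : ℝ) : ℝ := t * (1 - t) * Real.log (t / (1 - t))

lemma weightLogit_eq (t : ℝ) :
    weightLogit t = (1 - t) * (t * Real.log t) - t * ((1 - t) * Real.log (1 - t)) := by
  unfold weightLogit
  by_cases h0 : t = 0
  · simp [h0]
  by_cases h1 : 1 - t = 0
  · simp [h1]
  rw [Real.log_div h0 h1]; ring

lemma continuous_weightLogit : Continuous weightLogit := by
  have h1 : Continuous fun t : ℝ => t * Real.log t := Real.continuous_mul_log
  have h2 : Continuous fun t : ℝ => (1 - t) * Real.log (1 - t) :=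
    Real.continuous_mul_log.comp (continuous_const.sub continuous_id)
  rw [show weightLogit = _ from funext weightLogit_eq]
  fun_prop

lemma weightLogit_one_sub (t : ℝ) : weightLogit (1 - t) = -weightLogit t := by
  rw [weightLogit_eq, weightLogit_eq]; ring_nf

lemma integral_weightLogit : ∫ x in (0 : ℝ)..1, weightLogit x = 0 := by
  have h := intervalIntegral.integral_comp_sub_left (a := 0) (b := 1) weightLogit 1
  simp only [weightLogit_one_sub, sub_self, sub_zero, intervalIntegral.integral_neg] at h
  linarith

lemma hasDerivAt_logit {t : ℝ} (h0 : t ≠ 0) (h1 : 1 - t ≠ 0) :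
    HasDerivAt (fun t => Real.log (t / (1 - t))) (1 / (t * (1 - t))) t := by
  have := ((hasDerivAt_id t).div ((hasDerivAt_id t).const_sub 1) h1).log (div_ne_zero h0 h1)
  refine this.congr_deriv ?_
  simp only [id, Pi.div_apply]
  field_simp
  ring

namespace realLegendre

open Polynomial

lemma eval_ode_derivative (n : ℕ) (x : ℝ) :
    -2 * (derivative (realLegendre n)).eval x
      + 2 * (1 - 2 * x) * (derivative (derivative (realLegendre n))).eval x
      + x * (1 - x) * (derivative (derivative (derivative (realLegendre n)))).eval x
      = -((n : ℝ) * (n + 1)) * (derivative (realLegendre n)).eval x := by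
  have h := congrArg (fun p => eval x (derivative p)) (derivative_weight_mul_derivative n)
  simp only [derivative_mul, weight, eval_add, eval_mul, eval_C, eval_sub, eval_X, eval_pow,
    derivative_sub, derivative_X, derivative_X_pow, derivative_C, derivative_add] at h
  norm_num at h
  linear_combination h

/-- For `p = P_n'`, the differentiated Legendre equation reads `(w² p')' = (2 - n(n+1)) w p`. With
`L` the logit, `L' = 1/w`, so `w² L p' - w p` has derivative `-(n(n+1) - 2) w L p + (2x - 1)p` and
vanishes at both ends. At `n = 1` the identity is `0 = 0` and determines nothing. -/
lemma integral_derivative_mul_weightLogit_aux {n : ℕ} (hn : n ≠ 0) :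
    ((n : ℝ) * (n + 1) - 2)
        * ∫ x in (0 : ℝ)..1, (derivative (realLegendre n)).eval x * weightLogit x
      = 1 + (-1) ^ n := by
  set p := derivative (realLegendre n) with hp
  have hcont : Continuous fun x : ℝ =>
      x * (1 - x) * ((derivative p).eval x * weightLogit x - p.eval x) := by
    have := continuous_weightLogit
    fun_prop
  have hcont' : Continuous fun x : ℝ => -((n : ℝ) * (n + 1) - 2) * (p.eval x * weightLogit x)
      + ((2 * X - 1) * p).eval x := by
    have := continuous_weightLogit
    fun_prop
  have h := intervalIntegral.integral_eq_sub_of_hasDerivAt_of_le (a := 0) (b := 1)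
    (f := fun x : ℝ => x * (1 - x) * ((derivative p).eval x * weightLogit x - p.eval x))
    (f' := fun x : ℝ => -((n : ℝ) * (n + 1) - 2) * (p.eval x * weightLogit x)
      + ((2 * X - 1) * p).eval x)
    zero_le_one hcont.continuousOn (fun x hx => by
      have h0 : x ≠ 0 := hx.1.ne'
      have h1 : 1 - x ≠ 0 := (sub_pos.2 hx.2).ne'
      have hw : HasDerivAt (fun x : ℝ => x * (1 - x)) (1 - 2 * x) x := by
        refine ((hasDerivAt_id x).mul ((hasDerivAt_id x).const_sub 1)).congr_deriv ?_
        simp only [id]; ring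
      have hL : HasDerivAt weightLogit
          ((1 - 2 * x) * Real.log (x / (1 - x)) + x * (1 - x) * (1 / (x * (1 - x)))) x :=
        hw.mul (hasDerivAt_logit h0 h1)
      refine (hw.mul (((derivative p).hasDerivAt x |>.mul hL).sub (p.hasDerivAt x))).congr_deriv ?_
      have ode := eval_ode_derivative n x
      rw [← hp] at ode
      simp only [eval_mul, eval_sub, eval_X, eval_ofNat, Polynomial.eval_one, weightLogit,
        Pi.mul_apply, Pi.sub_apply]
      rw [mul_one_div_cancel (mul_ne_zero h0 h1)]
      linear_combination (x * (1 - x) * Real.log (x / (1 - x))) * ode)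
    (hcont'.intervalIntegrable _ _)
  have i1 : IntervalIntegrable (fun x => p.eval x * weightLogit x) volume 0 1 :=
    (p.continuous.mul continuous_weightLogit).intervalIntegrable _ _
  rw [intervalIntegral.integral_add (i1.const_mul _) (intervalIntegrable_eval _ _ _),
    intervalIntegral.integral_const_mul, ← polyIntegral_apply, hp,
    polyIntegral_linear_mul_derivative hn] at h
  simp only [sub_self, zero_mul, mul_zero] at h
  linear_combination -h

lemma integral_derivative_mul_weightLogit_of_ne_one {n : ℕ} (hn : n ≠ 0) (hn1 : n ≠ 1) :
    ∫ x in (0 : ℝ)..1, (derivative (realLegendre n)).eval x * weightLogit x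
      = (1 + (-1) ^ n) / ((n - 1) * (n + 2)) := by
  have h := integral_derivative_mul_weightLogit_aux hn
  have h1 : (n : ℝ) - 1 ≠ 0 := sub_ne_zero.2 (by exact_mod_cast hn1)
  rw [eq_div_iff (mul_ne_zero h1 (by positivity))]
  linear_combination h

lemma derivative_one : derivative (realLegendre 1) = C (-2) := by
  ext k
  rw [coeff_derivative, coeff_eq, coeff_C]
  rcases k with _ | k
  · norm_num
  · simp [Nat.choose_eq_zero_of_lt (show 1 < k + 1 + 1 by omega)]

/-- The general formula excludes `n = 1`; there `P_1'` is constant and antisymmetry of `weightLogit`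
about `1/2` is used instead. -/
lemma integral_derivative_mul_weightLogit_of_odd {n : ℕ} (hn : Odd n) :
    ∫ x in (0 : ℝ)..1, (derivative (realLegendre n)).eval x * weightLogit x = 0 := by
  by_cases h1 : n = 1
  · simp [h1, derivative_one, integral_weightLogit]
  · rw [integral_derivative_mul_weightLogit_of_ne_one hn.pos.ne' h1, hn.neg_one_pow]; simp

lemma integral_derivative_mul_weightLogit_two_mul {l : ℕ} (hl : l ≠ 0) :
    ∫ x in (0 : ℝ)..1, (derivative (realLegendre (2 * l))).eval x * weightLogit x
      = 1 / ((2 * l - 1) * (l + 1)) := by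
  rw [integral_derivative_mul_weightLogit_of_ne_one (by omega) (by omega)]
  have h1 : (2 * (l : ℝ) - 1) ≠ 0 := by
    have : (1 : ℝ) ≤ l := by exact_mod_cast Nat.one_le_iff_ne_zero.2 hl
    linarith
  push_cast
  rw [pow_mul]
  field_simp
  norm_num

end realLegendre

/-! ### The bridge covariance as a Green function -/

/-- The covariance function of the Brownian bridge. -/
noncomputable def bridgeKernel (s t : ℝ) : ℝ := min s t - s * t

open Polynomial in
/-- `bridgeKernel` is the Green function of `-u'' = f`, `u 0 = u 1 = 0`. -/
lemma integral_bridgeKernel_mul (u : ℝ[X]) (h0 : u.eval 0 = 0) (h1 : u.eval 1 = 0) {s : ℝ}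
    (hs : s ∈ Set.Icc (0 : ℝ) 1) :
    ∫ t in (0 : ℝ)..1, bridgeKernel s t * (derivative (derivative u)).eval t = -u.eval s := by
  set q := derivative (derivative u) with hq
  have hint : ∀ a b : ℝ, IntervalIntegrable (fun t => bridgeKernel s t * q.eval t) volume a b := by
    intro a b
    apply Continuous.intervalIntegrable
    unfold bridgeKernel
    fun_prop
  -- For `t ≤ s` the kernel is `t(1-s)` and `t u'' = (t u' - u)'`; for `t ≥ s` it is `s(1-t)` and
  -- `(1-t)u'' = ((1-t)u' + u)'`. The `u'(s)` contributions cancel in the sum.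
  have e1 : ∫ t in (0 : ℝ)..s, bridgeKernel s t * q.eval t
      = ∫ t in (0 : ℝ)..s, (derivative (C (1 - s) * (X * derivative u - u))).eval t := by
    apply intervalIntegral.integral_congr
    intro t ht
    rw [Set.uIcc_of_le hs.1] at ht
    simp only [bridgeKernel, min_eq_right ht.2, derivative_mul, derivative_C, derivative_sub,
      derivative_X, eval_add, eval_mul, eval_C, eval_sub, eval_X, zero_mul, one_mul,
      zero_add, ← hq]
    ring
  have e2 : ∫ t in s..1, bridgeKernel s t * q.eval t
      = ∫ t in s..1, (derivative (C s * ((1 - X) * derivative u + u))).eval t := by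
    apply intervalIntegral.integral_congr
    intro t ht
    rw [Set.uIcc_of_le hs.2] at ht
    simp only [bridgeKernel, min_eq_left ht.1, derivative_mul, derivative_add, derivative_C, derivative_sub,
      derivative_X, eval_add, eval_mul, eval_C, eval_sub, eval_X, eval_zero, zero_mul,
      zero_add, ← hq, derivative_one, Polynomial.eval_one]
    ring
  rw [← intervalIntegral.integral_add_adjacent_intervals (hint 0 s) (hint s 1), e1, e2,
    integral_eval_derivative, integral_eval_derivative]
  simp only [eval_mul, eval_C, eval_sub, eval_X, eval_add, Polynomial.eval_one, h0, h1]
  ring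

-- Apply the Green function to `u = w P_n'`: it vanishes at both ends, and differentiating the
-- Legendre equation gives `u'' = -n(n+1) P_n'`.
open Polynomial realLegendre in
lemma integral_bridgeKernel_mul_derivative {n : ℕ} (hn : n ≠ 0) {s : ℝ}
    (hs : s ∈ Set.Icc (0 : ℝ) 1) :
    ∫ t in (0 : ℝ)..1, bridgeKernel s t * (derivative (realLegendre n)).eval t
      = (weight * derivative (realLegendre n)).eval s / (n * (n + 1)) := by
  have h := integral_bridgeKernel_mul (weight * derivative (realLegendre n))
    (by simp [eval_weight]) (by simp [eval_weight]) hs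
  rw [derivative_weight_mul_derivative] at h
  simp only [derivative_C_mul, eval_mul, eval_C] at h
  have h2 : ∀ t, bridgeKernel s t * (-((n : ℝ) * (n + 1)) * (derivative (realLegendre n)).eval t)
      = -((n : ℝ) * (n + 1)) * (bridgeKernel s t * (derivative (realLegendre n)).eval t) :=
    fun t => by ring
  simp only [h2, intervalIntegral.integral_const_mul] at h
  have hn' : (n : ℝ) ≠ 0 := by exact_mod_cast hn
  rw [eval_mul, eq_div_iff (by positivity)]
  linear_combination -h

/-! ### The weighted `L²` space and its Jacobi basis -/

/-- The weight `t (1 - t)` on the unit interval. -/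
noncomputable def bridgeWeight (t : unitInterval) : NNReal :=
  ⟨(t : ℝ) * (1 - t), mul_nonneg t.2.1 (sub_nonneg.2 t.2.2)⟩

lemma coe_bridgeWeight (t : unitInterval) : (bridgeWeight t : ℝ) = (t : ℝ) * (1 - t) := rfl

lemma continuous_bridgeWeight : Continuous bridgeWeight := by
  refine Continuous.subtype_mk ?_ _
  fun_prop

lemma bridgeWeight_le_one (t : unitInterval) : bridgeWeight t ≤ 1 := by
  rw [← NNReal.coe_le_coe, coe_bridgeWeight]
  have h0 := t.2.1
  have h1 := t.2.2
  push_cast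
  nlinarith

lemma ae_bridgeWeight_ne_zero : ∀ᵐ t : unitInterval, (t : ℝ) * (1 - t) ≠ 0 := by
  have h0 : ∀ᵐ t : unitInterval, t ≠ 0 := Measure.ae_ne volume 0
  have h1 : ∀ᵐ t : unitInterval, t ≠ 1 := Measure.ae_ne volume 1
  filter_upwards [h0, h1] with t h0 h1
  refine mul_ne_zero (fun h => h0 (Subtype.ext h)) (fun h => h1 (Subtype.ext ?_))
  simp only [Set.Icc.coe_one]
  linarith

/-- The measure `t (1 - t) dt` on the unit interval. -/
noncomputable def bridgeMeasure : Measure unitInterval :=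
  volume.withDensity fun t => (bridgeWeight t : ENNReal)

instance : IsFiniteMeasure bridgeMeasure :=
  isFiniteMeasure_withDensity (ne_of_lt (lt_of_le_of_lt (lintegral_mono
    (g := fun _ => 1) fun t =>
      ENNReal.coe_le_one_iff.2 (bridgeWeight_le_one t)) (by simp)))

lemma integral_bridgeMeasure (f : unitInterval → ℝ) :
    ∫ t, f t ∂bridgeMeasure = ∫ t : unitInterval, (t : ℝ) * (1 - t) * f t :=
  integral_withDensity_eq_integral_smul continuous_bridgeWeight.measurable f

lemma integrable_bridgeMeasure_iff {f : unitInterval → ℝ} :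
    Integrable f bridgeMeasure ↔ Integrable fun t : unitInterval => (t : ℝ) * (1 - t) * f t :=
  integrable_withDensity_iff_integrable_smul continuous_bridgeWeight.measurable

/-- A polynomial as an element of `L²(t (1 - t) dt)`. -/
noncomputable def polyToL2 : Polynomial ℝ →ₗ[ℝ] Lp ℝ 2 bridgeMeasure :=
  (ContinuousMap.toLp 2 bridgeMeasure ℝ).toLinearMap ∘ₗ
    (Polynomial.toContinuousMapOnAlgHom unitInterval).toLinearMap

lemma polyToL2_ae_eq (p : Polynomial ℝ) :
    polyToL2 p =ᵐ[bridgeMeasure] fun t => p.eval (t : ℝ) :=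
  ContinuousMap.coeFn_toLp _ _

/-- Weierstrass approximation combined with density of continuous functions in `L²` of a finite
measure. -/
lemma denseRange_polyToL2 : DenseRange polyToL2 := by
  have h1 : DenseRange (ContinuousMap.toLp 2 bridgeMeasure ℝ :
      C(unitInterval, ℝ) →L[ℝ] Lp ℝ 2 bridgeMeasure) :=
    ContinuousMap.toLp_denseRange ℝ bridgeMeasure ℝ (by simp)
  have h2 : DenseRange (Polynomial.toContinuousMapOnAlgHom unitInterval :
      Polynomial ℝ → C(unitInterval, ℝ)) := by
    have := polynomialFunctions.topologicalClosure unitInterval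
    rw [polynomialFunctions, Algebra.map_top] at this
    intro x
    have hx : x ∈ (Polynomial.toContinuousMapOnAlgHom (unitInterval)).range.topologicalClosure := by
      rw [this]; trivial
    exact hx
  exact h1.comp h2 (ContinuousLinearMap.continuous _)

lemma inner_toLp_toLp {f g : unitInterval → ℝ} (hf : MemLp f 2 bridgeMeasure)
    (hg : MemLp g 2 bridgeMeasure) :
    inner ℝ (hf.toLp f) (hg.toLp g) = ∫ t : unitInterval, (t : ℝ) * (1 - t) * (f t * g t) := by
  rw [L2.inner_def, ← integral_bridgeMeasure]
  refine integral_congr_ae ?_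
  filter_upwards [hf.coeFn_toLp, hg.coeFn_toLp] with t h1 h2
  rw [h1, h2]
  simp [mul_comm]

lemma memLp_polynomial (p : Polynomial ℝ) :
    MemLp (fun t : unitInterval => p.eval (t : ℝ)) 2 bridgeMeasure :=
  (memLp_congr_ae (polyToL2_ae_eq p)).1 (Lp.memLp _)

lemma polyToL2_eq (p : Polynomial ℝ) : polyToL2 p = (memLp_polynomial p).toLp _ :=
  (Lp.toLp_coeFn (polyToL2 p) (Lp.memLp _)).symm.trans
    (MemLp.toLp_congr _ _ (polyToL2_ae_eq p))

lemma inner_polyToL2 (p q : Polynomial ℝ) :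
    inner ℝ (polyToL2 p) (polyToL2 q) = polyIntegral (realLegendre.weight * (p * q)) := by
  rw [polyToL2_eq, polyToL2_eq, inner_toLp_toLp, polyIntegral_apply,
    integral_unitInterval_eq fun t => t * (1 - t) * (p.eval t * q.eval t)]
  simp only [Polynomial.eval_mul, realLegendre.eval_weight]

-- The derivative of `P_{n+1}` has degree exactly `n`, so these derivatives contain one polynomial
-- of every degree.
open Polynomial in
lemma span_derivative_realLegendre :
    Submodule.span ℝ (Set.range fun k : ℕ+ => derivative (realLegendre k)) = ⊤ := by
  let S : Polynomial.Sequence ℝ :=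
    { elems' := fun n => derivative (realLegendre (n + 1))
      degree_eq' := fun n => by
        rw [degree_eq_natDegree, natDegree_derivative, realLegendre.natDegree_eq]
        · simp
        · intro h
          have := derivative_eq_zero.1 h
          simp [realLegendre.natDegree_eq] at this }
  have h := S.span fun n => isUnit_iff_ne_zero.2 (by simp)
  rw [← top_le_iff, ← h]
  refine Submodule.span_mono ?_
  rintro _ ⟨n, rfl⟩
  exact ⟨n.succPNat, rfl⟩

/-- The orthonormalised derivatives of the shifted Legendre polynomials. -/
noncomputable def jacobiL2 (k : ℕ+) : Lp ℝ 2 bridgeMeasure :=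
  √((2 * k + 1) / (k * (k + 1))) • polyToL2 (Polynomial.derivative (realLegendre k))

lemma orthonormal_jacobiL2 : Orthonormal ℝ jacobiL2 := by
  rw [orthonormal_iff_ite]
  intro i j
  have hi : (0 : ℝ) < i := by exact_mod_cast i.pos
  rw [jacobiL2, jacobiL2, real_inner_smul_left, real_inner_smul_right, inner_polyToL2]
  split_ifs with h
  · subst h
    rw [realLegendre.polyIntegral_weight_mul_derivative_sq, ← mul_assoc,
      Real.mul_self_sqrt (by positivity)]
    field_simp
  · rw [realLegendre.polyIntegral_weight_mul_derivative_of_ne (by exact_mod_cast h)]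
    simp

lemma dense_span_jacobiL2 :
    ⊤ ≤ (Submodule.span ℝ (Set.range jacobiL2)).topologicalClosure := by
  have h : LinearMap.range polyToL2 ≤ Submodule.span ℝ (Set.range jacobiL2) := by
    rw [LinearMap.range_eq_map, ← span_derivative_realLegendre, Submodule.map_span,
      Submodule.span_le]
    rintro _ ⟨_, ⟨k, rfl⟩, rfl⟩
    have hk : (0 : ℝ) < k := by exact_mod_cast k.pos
    have hs : √((2 * (k : ℝ) + 1) / (k * (k + 1))) ≠ 0 :=
      (Real.sqrt_pos.2 (by positivity)).ne'
    have : polyToL2 (Polynomial.derivative (realLegendre k))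
        = (√((2 * (k : ℝ) + 1) / (k * (k + 1))))⁻¹ • jacobiL2 k := by
      rw [jacobiL2, smul_smul, inv_mul_cancel₀ hs, one_smul]
    simp only [this]
    exact Submodule.smul_mem _ _ (Submodule.subset_span ⟨k, rfl⟩)
  intro x _
  exact closure_mono (show (Set.range polyToL2 : Set _) ⊆ _ from h) (denseRange_polyToL2 x)

/-- The Hilbert basis of `L²(t (1 - t) dt)` given by `jacobiL2`. -/
noncomputable def jacobiBasis : HilbertBasis ℕ+ ℝ (Lp ℝ 2 bridgeMeasure) :=
  HilbertBasis.mk orthonormal_jacobiL2 dense_span_jacobiL2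

open Polynomial in
/-- Parseval's identity for the Jacobi basis. -/
lemma hasSum_jacobi {f g : unitInterval → ℝ} (hf : MemLp f 2 bridgeMeasure)
    (hg : MemLp g 2 bridgeMeasure) :
    HasSum (fun k : ℕ+ => (2 * (k : ℝ) + 1) / (k * (k + 1))
        * (∫ t : unitInterval, (t : ℝ) * (1 - t) * (f t * (derivative (realLegendre k)).eval (t : ℝ)))
        * ∫ t : unitInterval, (t : ℝ) * (1 - t) * (g t * (derivative (realLegendre k)).eval (t : ℝ)))
      (∫ t : unitInterval, (t : ℝ) * (1 - t) * (f t * g t)) := by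
  have h := jacobiBasis.hasSum_inner_mul_inner (hf.toLp f) (hg.toLp g)
  rw [inner_toLp_toLp] at h
  refine h.congr_fun ?_
  intro k
  have hk : (0 : ℝ) < k := by exact_mod_cast k.pos
  rw [show jacobiBasis k = jacobiL2 k by rw [jacobiBasis, HilbertBasis.coe_mk], jacobiL2,
    real_inner_smul_right, real_inner_smul_left, real_inner_comm, polyToL2_eq, inner_toLp_toLp,
    inner_toLp_toLp]
  rw [mul_mul_mul_comm, Real.mul_self_sqrt (by positivity)]
  simp only [mul_comm (eval _ _), mul_assoc]

lemma integrable_logit : Integrable fun t : unitInterval => Real.log ((t : ℝ) / (1 - t)) := by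
  have e : (fun t : ℝ => Real.log (t / (1 - t))) = fun t => Real.log t - Real.log (1 - t) := by
    ext t
    by_cases h0 : t = 0
    · simp [h0]
    by_cases h1 : 1 - t = 0
    · have : t = 1 := by linarith
      simp [this]
    exact Real.log_div h0 h1
  rw [integrable_unitInterval_iff (f := fun t => Real.log (t / (1 - t))), e]
  have h := intervalIntegral.intervalIntegrable_log' (a := 0) (b := 1)
  refine h.sub ?_
  have := h.comp_sub_left 1
  simpa using this.symm

lemma aestronglyMeasurable_bridgeMeasure {f : unitInterval → ℝ}
    (hf : AEStronglyMeasurable f volume) : AEStronglyMeasurable f bridgeMeasure :=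
  hf.mono_ac (withDensity_absolutelyContinuous _ _)

/-- The function `log (t / (1 - t))` belongs to `L²(t (1 - t) dt)`. -/
lemma memLp_logit :
    MemLp (fun t : unitInterval => Real.log ((t : ℝ) / (1 - t))) 2 bridgeMeasure := by
  rw [memLp_two_iff_integrable_sq
    (aestronglyMeasurable_bridgeMeasure integrable_logit.aestronglyMeasurable),
    integrable_bridgeMeasure_iff]
  let F : C(unitInterval, ℝ) := ⟨fun t => weightLogit t, by
    have := continuous_weightLogit; fun_prop⟩
  -- With `L` the logit, `w L² = (w L) L` is a bounded continuous function times an integrable one.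
  have h := integrable_logit.bdd_mul (c := ‖F‖) (f := F) F.continuous.aestronglyMeasurable
    (Filter.Eventually.of_forall F.norm_coe_le_norm)
  refine h.congr (Filter.Eventually.of_forall fun t => ?_)
  simp only [F, ContinuousMap.coe_mk, weightLogit]
  ring

/-! ### Parseval expansions along a fixed path -/

section Path

variable {b : unitInterval → ℝ}

lemma integrable_continuous_mul_logit (hb : Continuous b) :
    Integrable fun t : unitInterval => b t * Real.log ((t : ℝ) / (1 - t)) :=
  integrable_logit.bdd_mul (c := ‖(⟨b, hb⟩ : C(unitInterval, ℝ))‖) hb.aestronglyMeasurable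
    (Filter.Eventually.of_forall (ContinuousMap.norm_coe_le_norm ⟨b, hb⟩))

/-- Turns weighted pairings of `b/w` into unweighted integrals of `b`. It holds only almost
everywhere because `w` vanishes at the endpoints. -/
lemma ae_weight_mul_div (b g : unitInterval → ℝ) :
    ∀ᵐ t : unitInterval, (t : ℝ) * (1 - t) * (b t / ((t : ℝ) * (1 - t)) * g t) = b t * g t := by
  filter_upwards [ae_bridgeWeight_ne_zero] with t ht
  rw [← mul_assoc, mul_div_cancel₀ _ ht]

lemma memLp_div_weight (hb : Continuous b)
    (hint : Integrable fun t : unitInterval => b t ^ 2 / ((t : ℝ) * (1 - t))) :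
    MemLp (fun t : unitInterval => b t / ((t : ℝ) * (1 - t))) 2 bridgeMeasure := by
  have hm : AEStronglyMeasurable (fun t : unitInterval => b t / ((t : ℝ) * (1 - t))) volume := by
    apply Measurable.aestronglyMeasurable
    have := hb.measurable
    fun_prop
  rw [memLp_two_iff_integrable_sq (aestronglyMeasurable_bridgeMeasure hm),
    integrable_bridgeMeasure_iff]
  refine hint.congr ?_
  filter_upwards [ae_bridgeWeight_ne_zero] with t ht
  field_simp

/-- The Legendre coefficients of the (generalised) derivative of `b`, up to sign. -/
noncomputable def legendreCoeff (b : unitInterval → ℝ) (k : ℕ+) : ℝ :=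
  √(2 * k + 1)
    * ∫ t : unitInterval, b t * (Polynomial.derivative (realLegendre k)).eval (t : ℝ)

lemma hasSum_sq_div_weight (hb : Continuous b)
    (hint : Integrable fun t : unitInterval => b t ^ 2 / ((t : ℝ) * (1 - t))) :
    HasSum (fun k : ℕ+ => legendreCoeff b k ^ 2 / (k * (k + 1)))
      (∫ t : unitInterval, b t ^ 2 / ((t : ℝ) * (1 - t))) := by
  have h := hasSum_jacobi (memLp_div_weight hb hint) (memLp_div_weight hb hint)
  simp only [integral_congr_ae (ae_weight_mul_div b _)] at h
  convert! h using 1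
  · ext k
    have hk : (0 : ℝ) < k := by exact_mod_cast k.pos
    rw [legendreCoeff, mul_pow, Real.sq_sqrt (by positivity)]
    ring
  · congr 1
    ext t
    ring

/-- Parseval between `b/w` and the logit. The odd Jacobi coefficients of the logit vanish, which
permits reindexing by `k = 2l`. -/
lemma hasSum_mul_logit (hb : Continuous b)
    (hint : Integrable fun t : unitInterval => b t ^ 2 / ((t : ℝ) * (1 - t))) :
    HasSum (fun l : ℕ+ => √(4 * l + 1) / (2 * l * (l + 1) * (2 * l - 1) * (2 * l + 1))
        * legendreCoeff b (2 * l))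
      (∫ t : unitInterval, b t * Real.log ((t : ℝ) / (1 - t))) := by
  have h := hasSum_jacobi (memLp_div_weight hb hint) memLp_logit
  simp only [integral_congr_ae (ae_weight_mul_div b _)] at h
  have e : ∀ k : ℕ, ∫ t : unitInterval, (t : ℝ) * (1 - t) * (Real.log ((t : ℝ) / (1 - t))
      * (Polynomial.derivative (realLegendre k)).eval (t : ℝ))
      = ∫ x in (0 : ℝ)..1, (Polynomial.derivative (realLegendre k)).eval x * weightLogit x := by
    intro k
    rw [integral_unitInterval_eq fun t => t * (1 - t) * (Real.log (t / (1 - t))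
      * (Polynomial.derivative (realLegendre k)).eval t)]
    congr 1
    ext x
    rw [weightLogit]; ring
  simp only [e] at h
  have hinj : Function.Injective fun l : ℕ+ => 2 * l := mul_right_injective 2
  rw [← hinj.hasSum_iff] at h
  · refine h.congr_fun fun l => ?_
    have hl : (1 : ℝ) ≤ l := by exact_mod_cast PNat.pos l
    have hl' : (2 : ℝ) * l - 1 ≠ 0 := by linarith
    have hc : (((2 * l : ℕ+) : ℕ) : ℝ) = 2 * l := by push_cast; rfl
    simp only [Function.comp, legendreCoeff, hc]
    rw [show ((2 * l : ℕ+) : ℕ) = 2 * (l : ℕ) from rfl,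
      realLegendre.integral_derivative_mul_weightLogit_two_mul l.ne_zero,
      show (2 * (2 * (l : ℝ)) + 1) = 4 * l + 1 by ring]
    have hs : √(4 * (l : ℝ) + 1) * √(4 * l + 1) = 4 * l + 1 := Real.mul_self_sqrt (by positivity)
    rw [div_mul_eq_mul_div, ← mul_assoc, hs]
    field_simp
  · intro k hk
    have : Odd (k : ℕ) := by
      rw [← Nat.not_even_iff_odd]
      rintro ⟨r, hr⟩
      have hr0 : 0 < r := by have := k.pos; omega
      exact hk ⟨⟨r, hr0⟩, PNat.coe_injective (by
        rw [hr]; exact two_mul r)⟩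
    rw [realLegendre.integral_derivative_mul_weightLogit_of_odd this, mul_zero]

/-- Since `P_1' = -2`, the first coefficient is `-2√3 ∫ b`; squaring removes the sign. -/
lemma integral_eq_legendreCoeff_one (b : unitInterval → ℝ) :
    (∫ t : unitInterval, 6 * b t) ^ 2 = 3 * legendreCoeff b 1 ^ 2 := by
  rw [legendreCoeff, mul_pow, Real.sq_sqrt (by positivity), PNat.one_coe,
    realLegendre.derivative_one]
  simp only [Polynomial.eval_C, integral_mul_const, integral_const_mul]
  push_cast
  ring

end Path

/-! ### Riemann sums along simple functions -/

lemma integral_comp_simpleFunc {α β : Type*} [MeasurableSpace α] (μ : Measure α)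
    [IsFiniteMeasure μ] (τ : SimpleFunc α β) (g : β → ℝ) :
    ∫ t, g (τ t) ∂μ = ∑ y ∈ τ.range, μ.real (τ ⁻¹' {y}) * g y := by
  have h : ∀ t, g (τ t) = ∑ y ∈ τ.range, (τ ⁻¹' {y}).indicator (fun _ => g y) t := by
    intro t
    rw [Finset.sum_eq_single (τ t)]
    · simp
    · intro y _ hy
      exact Set.indicator_of_notMem (fun h => hy h.symm) _
    · intro h
      exact absurd (τ.mem_range_self t) h
  simp only [h]
  rw [integral_finsetSum]
  · refine Finset.sum_congr rfl fun y _ => ?_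
    rw [integral_indicator_const _ (τ.measurableSet_preimage _), smul_eq_mul]
  · intro y _
    exact (integrable_const _).indicator (τ.measurableSet_preimage _)

/-- Simple functions approximating the identity of the unit interval. -/
noncomputable def unitApprox (n : ℕ) : SimpleFunc unitInterval unitInterval :=
  SimpleFunc.nearestPt (TopologicalSpace.denseSeq unitInterval) n

open Filter Topology

lemma tendsto_unitApprox (t : unitInterval) :
    Tendsto (fun n => unitApprox n t) atTop (𝓝 t) :=
  SimpleFunc.tendsto_nearestPt (TopologicalSpace.denseRange_denseSeq unitInterval t)

lemma tendsto_integral_unitApprox {g : unitInterval → ℝ} (hg : Continuous g) :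
    Tendsto (fun n => ∫ t, g (unitApprox n t)) atTop (𝓝 (∫ t, g t)) := by
  refine tendsto_integral_of_dominated_convergence
    (fun _ => ‖(⟨g, hg⟩ : C(unitInterval, ℝ))‖) (fun n => ?_) (integrable_const _)
    (fun n => Eventually.of_forall fun t => ?_) (Eventually.of_forall fun t => ?_)
  · exact ((unitApprox n).map g).aestronglyMeasurable
  · exact ContinuousMap.norm_coe_le_norm ⟨g, hg⟩ _
  · exact (hg.tendsto t).comp (tendsto_unitApprox t)

lemma tendsto_integral_integral_unitApprox {g : unitInterval → unitInterval → ℝ}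
    (hg : Continuous (Function.uncurry g)) :
    Tendsto (fun n => ∫ s, ∫ t, g (unitApprox n s) (unitApprox n t)) atTop
      (𝓝 (∫ s, ∫ t, g s t)) := by
  set C := ‖(⟨Function.uncurry g, hg⟩ : C(unitInterval × unitInterval, ℝ))‖
  have hC : ∀ s t, ‖g s t‖ ≤ C := fun s t =>
    ContinuousMap.norm_coe_le_norm (⟨Function.uncurry g, hg⟩ : C(_, ℝ)) (s, t)
  refine tendsto_integral_of_dominated_convergence (fun _ => C) (fun n => ?_) (integrable_const _)
    (fun n => Eventually.of_forall fun s => ?_) (Eventually.of_forall fun s => ?_)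
  · exact ((unitApprox n).map fun y => ∫ t, g y (unitApprox n t)).aestronglyMeasurable
  · refine (norm_integral_le_of_norm_le_const (Eventually.of_forall fun t => hC _ _)).trans ?_
    simp
  · refine tendsto_integral_of_dominated_convergence (fun _ => C) (fun n => ?_)
      (integrable_const _) (fun n => Eventually.of_forall fun t => hC _ _)
      (Eventually.of_forall fun t => ?_)
    · exact ((unitApprox n).map fun y => g (unitApprox n s) y).aestronglyMeasurable
    · exact (hg.tendsto (s, t)).comp ((tendsto_unitApprox s).prodMk_nhds (tendsto_unitApprox t))

/-! ### Gaussian functionals and integrability of the bridge -/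

namespace IsBrownianBridge

variable {Ω : Type*} [MeasurableSpace Ω] {P : Measure Ω} {B : unitInterval → Ω → ℝ}

lemma covariance_eq_bridgeKernel (hB : IsBrownianBridge B P) (s t : unitInterval) :
    cov[B s, B t; P] = bridgeKernel s t := hB.covariance_eq s t

lemma memLp_two (hB : IsBrownianBridge B P) (t : unitInterval) : MemLp (B t) 2 P :=
  (hB.isGaussianProcess.hasGaussianLaw_eval t).memLp_two

lemma charFun_finset_sum (hB : IsBrownianBridge B P) (s : Finset unitInterval)
    (c : unitInterval → ℝ) :
    ∫ ω, Complex.exp ((∑ y ∈ s, c y * B y ω : ℝ) * Complex.I) ∂P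
      = Complex.exp (-(∑ y ∈ s, ∑ z ∈ s, c y * (c z * bridgeKernel y z) : ℝ) / 2) := by
  have := hB.isGaussianProcess.isProbabilityMeasure
  have hX : HasGaussianLaw (fun ω => ∑ y ∈ s, c y * B y ω) P :=
    (hB.isGaussianProcess.smul c).hasGaussianLaw_fun_sum
  have hm : ∀ y, MemLp (fun ω => c y * B y ω) 2 P := fun y => (hB.memLp_two y).const_mul _
  have hmean : ∫ ω, ∑ y ∈ s, c y * B y ω ∂P = 0 := by
    rw [integral_finsetSum _ fun y _ => (hm y).integrable one_le_two]
    refine Finset.sum_eq_zero fun y _ => ?_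
    rw [integral_const_mul, hB.integral_eq_zero, mul_zero]
  have hvar : Var[fun ω => ∑ y ∈ s, c y * B y ω; P]
      = ∑ y ∈ s, ∑ z ∈ s, c y * (c z * bridgeKernel y z) := by
    rw [variance_fun_sum' fun y _ => hm y]
    refine Finset.sum_congr rfl fun y _ => Finset.sum_congr rfl fun z _ => ?_
    rw [covariance_const_mul_left, covariance_const_mul_right, hB.covariance_eq_bridgeKernel]
  have h := charFun_apply_real (μ := P.map fun ω => ∑ y ∈ s, c y * B y ω) 1
  rw [integral_map hX.aemeasurable (by fun_prop), hX.map_eq_gaussianReal, charFun_gaussianReal,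
    hmean, hvar, Real.coe_toNNReal _ (hvar ▸ variance_nonneg _ _)] at h
  simp only [Complex.ofReal_one, one_mul] at h
  rw [← h]
  congr 1
  simp
  ring

/-- The characteristic function of the Gaussian variable `∫ B f`. -/
lemma integral_exp_integral_mul (hB : IsBrownianBridge B P) {f : unitInterval → ℝ}
    (hf : Continuous f) :
    AEMeasurable (fun ω => ∫ t, B t ω * f t) P ∧
    ∫ ω, Complex.exp ((∫ t, B t ω * f t : ℝ) * Complex.I) ∂P
      = Complex.exp (-(∫ s, ∫ t, f s * (f t * bridgeKernel s t) : ℝ) / 2) := by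
  have := hB.isGaussianProcess.isProbabilityMeasure
  -- Weights of a Riemann sum for `∫ B f`. Such sums are finite combinations of the `B y`, hence
  -- Gaussian, and path continuity makes them converge almost surely. This also yields measurability
  -- of the integral in `ω`, without joint measurability of `B`.
  let c : ℕ → unitInterval → ℝ := fun n y => (volume : Measure unitInterval).real
    (unitApprox n ⁻¹' {y}) * f y
  have hsum : ∀ n ω, ∫ t, B (unitApprox n t) ω * f (unitApprox n t)
      = ∑ y ∈ (unitApprox n).range, c n y * B y ω := by
    intro n ω
    rw [integral_comp_simpleFunc volume (unitApprox n) fun y => B y ω * f y]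
    exact Finset.sum_congr rfl fun y _ => by simp only [c]; ring
  have hlim : ∀ᵐ ω ∂P, Tendsto (fun n => ∑ y ∈ (unitApprox n).range, c n y * B y ω) atTop
      (𝓝 (∫ t, B t ω * f t)) := by
    filter_upwards [hB.continuous_paths] with ω hω
    simp only [← hsum]
    exact tendsto_integral_unitApprox (hω.mul hf)
  have hmeas : ∀ n, AEMeasurable (fun ω => ∑ y ∈ (unitApprox n).range, c n y * B y ω) P :=
    fun n => Finset.aemeasurable_fun_sum _
      fun y _ => (hB.isGaussianProcess.aemeasurable y).const_mul _
  refine ⟨aemeasurable_of_tendsto_metrizable_ae atTop hmeas hlim, ?_⟩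
  have h1 : Tendsto (fun n => ∫ ω, Complex.exp
      ((∑ y ∈ (unitApprox n).range, c n y * B y ω : ℝ) * Complex.I) ∂P) atTop
      (𝓝 (∫ ω, Complex.exp ((∫ t, B t ω * f t : ℝ) * Complex.I) ∂P)) := by
    refine tendsto_integral_of_dominated_convergence (fun _ => 1) (fun n => ?_)
      (integrable_const _) (fun n => Eventually.of_forall fun ω => ?_) ?_
    · have hc : Continuous fun x : ℝ => Complex.exp (x * Complex.I) := by fun_prop
      exact hc.comp_aestronglyMeasurable (hmeas n).aestronglyMeasurable
    · exact (Complex.norm_exp_ofReal_mul_I _).le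
    · filter_upwards [hlim] with ω hω
      have hc : Continuous fun x : ℝ => Complex.exp (x * Complex.I) := by fun_prop
      exact (hc.tendsto _).comp hω
  have h2 : Tendsto (fun n => ∑ y ∈ (unitApprox n).range, ∑ z ∈ (unitApprox n).range,
      c n y * (c n z * bridgeKernel y z)) atTop
      (𝓝 (∫ s, ∫ t, f s * (f t * bridgeKernel s t))) := by
    have hk : Continuous (Function.uncurry fun s t : unitInterval =>
        f s * (f t * bridgeKernel s t)) := by
      simp only [Function.uncurry_def, bridgeKernel]
      fun_prop
    refine (tendsto_integral_integral_unitApprox hk).congr fun n => ?_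
    rw [integral_comp_simpleFunc volume (unitApprox n)
      fun y => ∫ t, f y * (f (unitApprox n t) * bridgeKernel y (unitApprox n t))]
    refine Finset.sum_congr rfl fun y _ => ?_
    rw [integral_comp_simpleFunc volume (unitApprox n) fun z => f y * (f z * bridgeKernel y z),
      Finset.mul_sum]
    refine Finset.sum_congr rfl fun z _ => ?_
    simp only [c]
    ring
  refine tendsto_nhds_unique h1 ?_
  simp only [hB.charFun_finset_sum]
  have hc : Continuous fun x : ℝ => Complex.exp (-x / 2) := by fun_prop
  exact (hc.tendsto _).comp h2

/-- The variance of `B t` is `t(1-t)`, so the value is `1` inside the interval; at the endpoints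
`0/0 = 0`, whence an inequality. -/
lemma lintegral_sq_div_weight_le (hB : IsBrownianBridge B P) (t : unitInterval) :
    ∫⁻ ω, ENNReal.ofReal (B t ω ^ 2 / ((t : ℝ) * (1 - t))) ∂P ≤ 1 := by
  have hw : 0 ≤ (t : ℝ) * (1 - t) := mul_nonneg t.2.1 (sub_nonneg.2 t.2.2)
  rw [← ofReal_integral_eq_lintegral_ofReal ((hB.memLp_two t).integrable_sq.div_const _)
    (Eventually.of_forall fun ω => by positivity), integral_div]
  have hv : ∫ ω, B t ω ^ 2 ∂P = (t : ℝ) * (1 - t) := by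
    have hm := hB.isGaussianProcess.aemeasurable t
    have h := hB.covariance_eq t t
    rw [covariance_self hm, variance_eq_integral hm, hB.integral_eq_zero, min_self] at h
    simp only [sub_zero] at h
    rw [h]; ring
  rw [hv]
  exact ENNReal.ofReal_le_one.2 (div_self_le_one _)

/-- Morally Tonelli: the integral has expectation at most `1`. Joint measurability is not assumed,
so the time integral is discretised, where the bound is a finite sum, and Fatou's lemma is applied
first in `ω`, then in `t`. -/
lemma ae_integrable_sq_div_weight (hB : IsBrownianBridge B P) :
    ∀ᵐ ω ∂P, Integrable fun t : unitInterval => B t ω ^ 2 / ((t : ℝ) * (1 - t)) := by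
  let g : unitInterval → Ω → ENNReal := fun t ω => ENNReal.ofReal (B t ω ^ 2 / ((t : ℝ) * (1 - t)))
  have hsum : ∀ n ω, ∫⁻ t, g (unitApprox n t) ω
      = ∑ y ∈ (unitApprox n).range, g y ω * volume (unitApprox n ⁻¹' {y}) := by
    intro n ω
    rw [← SimpleFunc.map_lintegral (fun y => g y ω), ← SimpleFunc.lintegral_eq_lintegral]
    rfl
  have hgm : ∀ y, AEMeasurable (g y) P := fun y =>
    (((hB.isGaussianProcess.aemeasurable y).pow_const 2).div_const _).ennreal_ofReal
  have hmeas : ∀ n, AEMeasurable (fun ω => ∫⁻ t, g (unitApprox n t) ω) P := by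
    intro n
    simp only [hsum]
    exact Finset.aemeasurable_fun_sum _ fun y _ => (hgm y).mul_const _
  have hle : ∀ n, ∫⁻ ω, (∫⁻ t, g (unitApprox n t) ω) ∂P ≤ 1 := by
    intro n
    simp only [hsum]
    rw [lintegral_finsetSum' _ fun y _ => (hgm y).mul_const _]
    calc ∑ y ∈ (unitApprox n).range, ∫⁻ ω, g y ω * volume (unitApprox n ⁻¹' {y}) ∂P
        ≤ ∑ y ∈ (unitApprox n).range, volume (unitApprox n ⁻¹' {y}) := by
          refine Finset.sum_le_sum fun y _ => ?_
          rw [lintegral_mul_const'' _ (hgm y)]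
          exact mul_le_of_le_one_left' (hB.lintegral_sq_div_weight_le y)
      _ = 1 := by rw [SimpleFunc.sum_range_measure_preimage_singleton]; simp
  have hfatou : ∫⁻ ω, liminf (fun n => ∫⁻ t, g (unitApprox n t) ω) atTop ∂P ≤ 1 :=
    (lintegral_liminf_le' hmeas).trans
      ((liminf_le_liminf (Eventually.of_forall hle)).trans (by simp))
  have hliminf : AEMeasurable
      (fun ω => liminf (fun n => ∫⁻ t, g (unitApprox n t) ω) atTop) P := by
    refine ⟨_, Measurable.liminf fun n => (hmeas n).measurable_mk, ?_⟩
    filter_upwards [ae_all_iff.2 fun n => (hmeas n).ae_eq_mk] with ω hω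
    simp only [hω]
  have hfin := ae_lt_top' hliminf (hfatou.trans_lt ENNReal.one_lt_top).ne
  filter_upwards [hfin, hB.continuous_paths] with ω hω hc
  have hlim : ∀ᵐ t : unitInterval, Tendsto (fun n => g (unitApprox n t) ω) atTop (𝓝 (g t ω)) := by
    filter_upwards [ae_bridgeWeight_ne_zero] with t ht
    have hcont : ContinuousAt (fun t : unitInterval => B t ω ^ 2 / ((t : ℝ) * (1 - t))) t :=
      ContinuousAt.div (hc.pow 2).continuousAt (by fun_prop) ht
    exact (ENNReal.continuous_ofReal.tendsto _).comp (hcont.tendsto.comp (tendsto_unitApprox t))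
  have hlt : ∫⁻ t, g t ω < ⊤ := by
    refine lt_of_le_of_lt ?_ hω
    rw [lintegral_congr_ae (hlim.mono fun t ht => ht.liminf_eq.symm)]
    exact lintegral_liminf_le' fun n => ((unitApprox n).map fun y => g y ω).aemeasurable
  have hm : Measurable fun t : unitInterval => B t ω ^ 2 / ((t : ℝ) * (1 - t)) := by
    have := hc.measurable
    fun_prop
  refine ⟨hm.aestronglyMeasurable, ?_⟩
  rw [hasFiniteIntegral_iff_ofReal (Eventually.of_forall fun t =>
    div_nonneg (sq_nonneg _) (mul_nonneg t.2.1 (sub_nonneg.2 t.2.2)))]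
  exact hlt

end IsBrownianBridge

/-! ### The Legendre coefficients of the bridge are white noise -/

/-- The linear combination of normalised derivatives of Legendre polynomials. -/
noncomputable def jacobiCombination {ι : Type*} [Fintype ι] (k : ι → ℕ+) (a : ι → ℝ) :
    Polynomial ℝ :=
  ∑ i, (a i * √(2 * k i + 1)) • Polynomial.derivative (realLegendre (k i))

lemma continuous_eval_unitInterval (p : Polynomial ℝ) :
    Continuous fun t : unitInterval => p.eval (t : ℝ) := by fun_prop

lemma integral_mul_jacobiCombination {ι : Type*} [Fintype ι] (k : ι → ℕ+) (a : ι → ℝ)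
    {b : unitInterval → ℝ} (hb : Continuous b) :
    ∫ t : unitInterval, b t * (jacobiCombination k a).eval (t : ℝ)
      = ∑ i, a i * legendreCoeff b (k i) := by
  simp only [jacobiCombination, Polynomial.eval_finsetSum, Polynomial.eval_smul, smul_eq_mul,
    Finset.mul_sum, legendreCoeff]
  rw [integral_finsetSum]
  · refine Finset.sum_congr rfl fun i _ => ?_
    rw [← mul_assoc, ← integral_const_mul]
    congr 1
    ext t
    ring
  · intro i _
    apply Continuous.integrable_of_hasCompactSupport _ (HasCompactSupport.of_compactSpace _)
    fun_prop

lemma integral_bridgeKernel_mul_jacobiCombination {ι : Type*} [Fintype ι] (k : ι → ℕ+)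
    (a : ι → ℝ) (s : unitInterval) :
    ∫ t : unitInterval, (jacobiCombination k a).eval (t : ℝ) * bridgeKernel s t
      = ∑ i, a i * √(2 * k i + 1) / (k i * (k i + 1))
        * (realLegendre.weight * Polynomial.derivative (realLegendre (k i))).eval (s : ℝ) := by
  have hk : Continuous fun t => bridgeKernel s t := by unfold bridgeKernel; fun_prop
  rw [integral_unitInterval_eq fun t => (jacobiCombination k a).eval t * bridgeKernel s t]
  simp only [jacobiCombination, Polynomial.eval_finsetSum, Polynomial.eval_smul, smul_eq_mul,
    Finset.sum_mul]
  rw [intervalIntegral.integral_finsetSum]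
  · refine Finset.sum_congr rfl fun i _ => ?_
    have h := integral_bridgeKernel_mul_derivative (k i).ne_zero s.2
    rw [div_mul_eq_mul_div, mul_div_assoc, ← h, ← intervalIntegral.integral_const_mul]
    congr 1
    ext t
    ring
  · intro i _
    apply Continuous.intervalIntegrable
    fun_prop

/-- The kernel multiplies `P_k'` by `w/(k(k+1))`, and `∫ w (P_k')² = k(k+1)/(2k+1)`, so the factor
`√(2k+1)` normalises each variance to `1`. Injectivity of `k` lets orthogonality remove the cross
terms. -/
lemma integral_integral_bridgeKernel_jacobiCombination {ι : Type*} [Fintype ι] {k : ι → ℕ+}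
    (hk : Function.Injective k) (a : ι → ℝ) :
    ∫ s : unitInterval, ∫ t : unitInterval, (jacobiCombination k a).eval (s : ℝ)
      * ((jacobiCombination k a).eval (t : ℝ) * bridgeKernel s t) = ∑ i, a i ^ 2 := by
  classical
  simp only [integral_const_mul, integral_bridgeKernel_mul_jacobiCombination]
  have e : ∀ s : ℝ, (jacobiCombination k a).eval s
      * (∑ i, a i * √(2 * k i + 1) / (k i * (k i + 1))
        * (realLegendre.weight * Polynomial.derivative (realLegendre (k i))).eval s)
      = (∑ j, ∑ i, (a j * √(2 * k j + 1) * (a i * √(2 * k i + 1) / (k i * (k i + 1)))) •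
        (realLegendre.weight * (Polynomial.derivative (realLegendre (k j))
          * Polynomial.derivative (realLegendre (k i))))).eval s := by
    intro s
    simp only [jacobiCombination, Polynomial.eval_finsetSum, Polynomial.eval_smul, smul_eq_mul,
      Finset.sum_mul_sum, Polynomial.eval_mul]
    exact Finset.sum_congr rfl fun j _ => Finset.sum_congr rfl fun i _ => by ring
  rw [integral_unitInterval_eq fun s => (jacobiCombination k a).eval s
      * (∑ i, a i * √(2 * k i + 1) / (k i * (k i + 1))
        * (realLegendre.weight * Polynomial.derivative (realLegendre (k i))).eval s)]
  simp only [e]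
  rw [← polyIntegral_apply]
  simp only [map_sum, map_smul, smul_eq_mul]
  refine Finset.sum_congr rfl fun j _ => ?_
  rw [Finset.sum_eq_single j]
  · have hj : (0 : ℝ) < k j := by exact_mod_cast (k j).pos
    have hs : √(2 * (k j : ℝ) + 1) * √(2 * (k j : ℝ) + 1) = 2 * k j + 1 :=
      Real.mul_self_sqrt (by positivity)
    rw [realLegendre.polyIntegral_weight_mul_derivative_sq]
    calc _ = a j ^ 2 * (√(2 * (k j : ℝ) + 1) * √(2 * (k j : ℝ) + 1))
          / (k j * (k j + 1)) * (k j * (k j + 1) / (2 * k j + 1)) := by ring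
      _ = a j ^ 2 := by rw [hs]; field_simp
  · intro i _ hij
    rw [realLegendre.polyIntegral_weight_mul_derivative_of_ne, mul_zero]
    intro h
    exact hij (hk (PNat.coe_injective h)).symm
  · intro h
    exact absurd (Finset.mem_univ j) h

namespace IsBrownianBridge

variable {Ω : Type*} [MeasurableSpace Ω] {P : Measure Ω} {B : unitInterval → Ω → ℝ}

/-- This joint characteristic function yields both facts needed: a single index gives the standard
normal law, and its factorisation gives independence. -/
lemma integral_exp_sum_legendreCoeff (hB : IsBrownianBridge B P) {ι : Type*} [Fintype ι]
    {k : ι → ℕ+} (hk : Function.Injective k) (a : ι → ℝ) :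
    ∫ ω, Complex.exp ((∑ i, a i * legendreCoeff (B · ω) (k i) : ℝ) * Complex.I) ∂P
      = Complex.exp (-(∑ i, a i ^ 2 : ℝ) / 2) := by
  have h := (hB.integral_exp_integral_mul
    (continuous_eval_unitInterval (jacobiCombination k a))).2
  rw [integral_integral_bridgeKernel_jacobiCombination hk] at h
  rw [← h]
  refine integral_congr_ae ?_
  filter_upwards [hB.continuous_paths] with ω hω
  rw [integral_mul_jacobiCombination k a hω]

lemma aemeasurable_legendreCoeff (hB : IsBrownianBridge B P) (k : ℕ+) :
    AEMeasurable (fun ω => legendreCoeff (B · ω) k) P :=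
  (hB.integral_exp_integral_mul (continuous_eval_unitInterval
    (Polynomial.derivative (realLegendre k)))).1.const_mul _

lemma charFun_map_legendreCoeff (hB : IsBrownianBridge B P) (k : ℕ+) (x : ℝ) :
    charFun (P.map fun ω => legendreCoeff (B · ω) k) x = Complex.exp (-(x ^ 2 : ℝ) / 2) := by
  rw [charFun_apply_real, integral_map (hB.aemeasurable_legendreCoeff k) (by fun_prop)]
  have h := hB.integral_exp_sum_legendreCoeff (k := fun _ : Unit => k)
    (Function.injective_of_subsingleton _) fun _ => x
  simpa using h

lemma map_legendreCoeff (hB : IsBrownianBridge B P) (k : ℕ+) :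
    P.map (fun ω => legendreCoeff (B · ω) k) = gaussianReal 0 1 := by
  have := hB.isGaussianProcess.isProbabilityMeasure
  have := Measure.isProbabilityMeasure_map (hB.aemeasurable_legendreCoeff k)
  refine Measure.ext_of_charFun ?_
  ext x
  rw [hB.charFun_map_legendreCoeff, charFun_gaussianReal]
  congr 1
  simp
  ring

lemma iIndepFun_legendreCoeff (hB : IsBrownianBridge B P) :
    iIndepFun (fun k ω => legendreCoeff (B · ω) k) P := by
  have := hB.isGaussianProcess.isProbabilityMeasure
  rw [iIndepFun_iff_finset]
  intro s
  have hm := fun i : s => hB.aemeasurable_legendreCoeff i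
  refine (iIndepFun_iff_charFun_pi (X := s.restrict fun k ω => legendreCoeff (B · ω) k) hm).2
    fun a => ?_
  have hm' : AEMeasurable (fun ω => WithLp.toLp 2 fun i : s => legendreCoeff (B · ω) i) P :=
    (WithLp.measurable_toLp 2 _).comp_aemeasurable (aemeasurable_pi_iff.2 hm)
  have h := hB.integral_exp_sum_legendreCoeff (k := fun i : s => (i : ℕ+))
    Subtype.val_injective a.ofLp
  rw [charFun_apply]
  refine (integral_map hm' (by fun_prop)).trans ?_
  refine Eq.trans ?_ (h.trans ?_)
  · simp [PiLp.inner_apply]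
  · refine Eq.trans ?_ (Finset.prod_congr rfl fun i _ =>
      (hB.charFun_map_legendreCoeff i (a.ofLp i)).symm)
    rw [← Complex.exp_sum]
    congr 1
    push_cast
    rw [neg_div, Finset.sum_div, ← Finset.sum_neg_distrib]
    simp only [neg_div]

/-- The law of the Legendre coefficients of a Brownian bridge is standard Gaussian white noise. -/
lemma map_fun_legendreCoeff (hB : IsBrownianBridge B P) :
    P.map (fun ω k => legendreCoeff (B · ω) k)
      = Measure.infinitePi fun _ : ℕ+ => gaussianReal 0 1 := by
  rw [hB.iIndepFun_legendreCoeff.map_fun_eq_infinitePi_map₀' hB.aemeasurable_legendreCoeff]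
  simp only [hB.map_legendreCoeff]

end IsBrownianBridge

/-! ### Almost sure convergence of the Gaussian series -/

/-- By Tonelli the sum of the absolute values has finite expectation, hence is almost surely finite.
-/
lemma ae_summable_of_summable_integral_norm {Ω ι : Type*} [MeasurableSpace Ω] {P : Measure Ω}
    [Countable ι] {X : ι → Ω → ℝ} (hX : ∀ i, Integrable (X i) P)
    (hs : Summable fun i => ∫ ω, ‖X i ω‖ ∂P) : ∀ᵐ ω ∂P, Summable fun i => X i ω := by
  have h : ∫⁻ ω, ∑' i, ‖X i ω‖ₑ ∂P ≠ ⊤ := by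
    rw [lintegral_tsum fun i => (hX i).aestronglyMeasurable.enorm]
    have : ∀ i, ∫⁻ ω, ‖X i ω‖ₑ ∂P = ENNReal.ofReal (∫ ω, ‖X i ω‖ ∂P) :=
      fun i => (ofReal_integral_norm_eq_lintegral_enorm (hX i)).symm
    simp only [this]
    exact hs.tsum_ofReal_ne_top
  have hm : AEMeasurable (fun ω => ∑' i, ‖X i ω‖ₑ) P :=
    AEMeasurable.tsum fun i => (hX i).aestronglyMeasurable.enorm
  filter_upwards [ae_lt_top' hm h] with ω hω
  have : Summable fun i => ‖X i ω‖₊ := by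
    rw [← ENNReal.tsum_coe_ne_top_iff_summable]
    exact hω.ne
  exact Summable.of_norm (NNReal.summable_coe.2 this)

lemma summable_pnat_inv_sq : Summable fun k : ℕ+ => 1 / (k : ℝ) ^ 2 :=
  (Real.summable_one_div_nat_pow.2 one_lt_two).comp_injective PNat.coe_injective

section GaussianSeries

variable {Ω : Type*} [MeasurableSpace Ω] {P : Measure Ω} {Z : ℕ+ → Ω → ℝ}

lemma ae_summable_mul_of_hasLaw {c : ℕ+ → ℝ} (hc : Summable c) (hc0 : ∀ k, 0 ≤ c k)
    {f : ℝ → ℝ} (hf : Integrable f (gaussianReal 0 1)) {m : ℕ+ → ℕ+}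
    (hZ : ∀ m, HasLaw (Z m) (gaussianReal 0 1) P) :
    ∀ᵐ ω ∂P, Summable fun k => c k * f (Z (m k) ω) := by
  have hi : ∀ k, Integrable (fun ω => f (Z k ω)) P := fun k => by
    have h := hf
    rw [← (hZ k).map_eq] at h
    exact h.comp_aemeasurable (hZ k).aemeasurable
  refine ae_summable_of_summable_integral_norm (fun k => (hi (m k)).const_mul _) ?_
  have : ∀ k, ∫ ω, ‖c k * f (Z (m k) ω)‖ ∂P = c k * ∫ x, ‖f x‖ ∂gaussianReal 0 1 := by
    intro k
    simp only [norm_mul, Real.norm_of_nonneg (hc0 k)]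
    rw [integral_const_mul, ← (hZ (m k)).integral_comp hf.aestronglyMeasurable.norm]
    rfl
  simp only [this]
  exact hc.mul_right _

lemma ae_summable_quadraticTerm (hZ : ∀ m, HasLaw (Z m) (gaussianReal 0 1) P) :
    ∀ᵐ ω ∂P, Summable fun k : ℕ+ => quadraticTerm Z k ω := by
  refine ae_summable_mul_of_hasLaw (c := fun k => 6 / (((k : ℝ) + 1) * ((k : ℝ) + 2)))
    (f := fun x => x ^ 2) (m := fun k => k + 1) ?_ (fun k => by positivity)
    (memLp_id_gaussianReal 2).integrable_sq hZ
  refine Summable.of_nonneg_of_le (fun k => by positivity) (fun k => ?_)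
    (summable_pnat_inv_sq.mul_left 6)
  have hk : (0 : ℝ) < k := by exact_mod_cast k.pos
  rw [mul_one_div]
  gcongr
  nlinarith

lemma linearTerm_coefficient_nonneg (l : ℕ+) :
    0 ≤ 3 * √(4 * (l : ℝ) + 1) / (l * (l + 1) * (2 * l - 1) * (2 * l + 1)) := by
  have hl : (1 : ℝ) ≤ l := by exact_mod_cast l.pos
  have : 0 < 2 * (l : ℝ) - 1 := by linarith
  positivity

lemma ae_summable_linearTerm (hZ : ∀ m, HasLaw (Z m) (gaussianReal 0 1) P) :
    ∀ᵐ ω ∂P, Summable fun l : ℕ+ => linearTerm Z l ω := by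
  refine ae_summable_mul_of_hasLaw (f := fun x => x) (m := fun l => 2 * l) ?_
    linearTerm_coefficient_nonneg ((memLp_id_gaussianReal 1).integrable (by simp)) hZ
  refine Summable.of_nonneg_of_le linearTerm_coefficient_nonneg (fun l => ?_)
    (summable_pnat_inv_sq.mul_left 3)
  have hl : (1 : ℝ) ≤ l := by exact_mod_cast l.pos
  have h1 : 1 ≤ 2 * (l : ℝ) - 1 := by linarith
  -- This absorbs the factor `2l + 1` of the denominator, leaving the bound `3/l²`.
  have hs : √(4 * (l : ℝ) + 1) ≤ 2 * l + 1 := by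
    rw [Real.sqrt_le_left (by positivity)]
    nlinarith
  rw [mul_div_assoc]
  gcongr 3 * ?_
  rw [div_le_div_iff₀ (by positivity) (by positivity), one_mul]
  calc √(4 * (l : ℝ) + 1) * (l : ℝ) ^ 2 ≤ (2 * (l : ℝ) + 1) * (l : ℝ) ^ 2 := by gcongr
    _ = (l : ℝ) * l * 1 * (2 * l + 1) := by ring
    _ ≤ (l : ℝ) * (l + 1) * (2 * l - 1) * (2 * l + 1) := by gcongr; linarith

end GaussianSeries

/-! ### Transfer of the law from the bridge to the Gaussian sequence -/

/-- The limit variable as a function of the Gaussian sequence. -/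
noncomputable def seriesLimit (x : ℕ+ → ℝ) : ℝ :=
  1 / (Real.pi ^ 2 / 3 - 2) * (∑' k : ℕ+, quadraticTerm (fun m (x : ℕ+ → ℝ) => x m) k x)
    - (1 / (Real.pi ^ 2 / 3 - 2) * ∑' l : ℕ+, linearTerm (fun m (x : ℕ+ → ℝ) => x m) l x) ^ 2

lemma aemeasurable_seriesLimit :
    AEMeasurable seriesLimit (Measure.infinitePi fun _ : ℕ+ => gaussianReal 0 1) := by
  have hZ : ∀ m : ℕ+, HasLaw (fun x : ℕ+ → ℝ => x m) (gaussianReal 0 1)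
      (Measure.infinitePi fun _ : ℕ+ => gaussianReal 0 1) := fun m =>
    ⟨(measurable_pi_apply m).aemeasurable, (measurePreserving_eval_infinitePi _ m).map_eq⟩
  have hq := AEMeasurable.tsum (L := .unconditional _)
    (f := quadraticTerm fun m (x : ℕ+ → ℝ) => x m)
    fun k => ((hZ (k + 1)).aemeasurable.pow_const 2).const_mul _
  have hl := AEMeasurable.tsum (L := .unconditional _)
    (f := linearTerm fun m (x : ℕ+ → ℝ) => x m)
    fun l => (hZ (2 * l)).aemeasurable.const_mul _
  exact (hq.const_mul _).sub ((hl.const_mul _).pow_const 2)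

lemma hasSum_pnat_succ {f : ℕ+ → ℝ} {a : ℝ} (h : HasSum f a) :
    HasSum (fun k => f (k + 1)) (a - f 1) := by
  have hinj : Function.Injective fun k : ℕ+ => k + 1 := add_left_injective 1
  have h' := h.sub (hasSum_ite_eq (1 : ℕ+) (f 1))
  rw [← hinj.hasSum_iff] at h'
  · refine h'.congr_fun fun k => ?_
    have : k + 1 ≠ 1 := (PNat.lt_add_left 1 k).ne'
    simp [Function.comp, this]
  · intro k hk
    have : k = 1 := by
      by_contra hne
      obtain ⟨j, rfl⟩ := PNat.exists_eq_succ_of_ne_one hne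
      exact hk ⟨j, rfl⟩
    simp [this]

/-- The pathwise series expansion of `limitV`. -/
lemma limitV_eq_seriesLimit {Ω : Type*} {B : unitInterval → Ω → ℝ} {ω : Ω}
    (hb : Continuous fun t => B t ω)
    (hint : Integrable fun t : unitInterval => B t ω ^ 2 / ((t : ℝ) * (1 - t))) :
    limitV B ω = seriesLimit fun k => legendreCoeff (B · ω) k := by
  -- The removed `k = 1` term, `6c_1²/(1·2) = 3c_1²`, is precisely `(∫ 6B)²`.
  have hq := hasSum_pnat_succ ((hasSum_sq_div_weight hb hint).mul_left 6)
  have hl := (hasSum_mul_logit hb hint).mul_left 6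
  have eq1 : ∑' k : ℕ+, quadraticTerm (fun m (x : ℕ+ → ℝ) => x m) k
      (fun k => legendreCoeff (B · ω) k)
      = (∫ t : unitInterval, 6 * B t ω ^ 2 / ((t : ℝ) * (1 - t)))
        - (∫ t : unitInterval, 6 * B t ω) ^ 2 := by
    rw [integral_eq_legendreCoeff_one]
    simp only [mul_div_assoc, integral_const_mul]
    convert! hq.tsum_eq using 1
    · refine tsum_congr fun k => ?_
      rw [quadraticTerm]
      push_cast
      ring
    · simp only [PNat.one_coe]
      push_cast
      ring
  have eq2 : ∑' l : ℕ+, linearTerm (fun m (x : ℕ+ → ℝ) => x m) l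
      (fun k => legendreCoeff (B · ω) k)
      = ∫ t : unitInterval, 6 * B t ω * Real.log ((t : ℝ) / (1 - t)) := by
    simp only [mul_assoc, integral_const_mul]
    rw [← hl.tsum_eq]
    refine tsum_congr fun l => ?_
    have hl : (1 : ℝ) ≤ l := by exact_mod_cast l.pos
    have h1 : 2 * (l : ℝ) - 1 ≠ 0 := by linarith
    rw [linearTerm]
    field_simp
    norm_num [mul_comm]
  rw [limitV, seriesLimit, eq1, eq2]

theorem theorem2
    {Ω : Type*} [MeasurableSpace Ω] (P : Measure Ω) [IsProbabilityMeasure P]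
    (B : unitInterval → Ω → ℝ) (hB : IsBrownianBridge B P)
    {Ω' : Type*} [MeasurableSpace Ω'] (P' : Measure Ω') [IsProbabilityMeasure P']
    (Z : ℕ+ → Ω' → ℝ) (hZ_law : ∀ m, HasLaw (Z m) (gaussianReal 0 1) P')
    (hZ_indep : iIndepFun Z P') :
    (∀ᵐ ω ∂P,
      Integrable (fun t : unitInterval => 6 * B t ω ^ 2 / ((t : ℝ) * (1 - (t : ℝ)))) ∧
      Integrable (fun t : unitInterval => 6 * B t ω) ∧
      Integrable (fun t : unitInterval => 6 * B t ω * Real.log ((t : ℝ) / (1 - (t : ℝ))))) ∧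
    (∀ᵐ ω ∂P', Summable (fun k : ℕ+ => quadraticTerm Z k ω)) ∧
    (∀ᵐ ω ∂P', Summable (fun l : ℕ+ => linearTerm Z l ω)) ∧
    IdentDistrib (limitV B)
      (fun ω => 1 / (Real.pi ^ 2 / 3 - 2) * (∑' k : ℕ+, quadraticTerm Z k ω)
        - (1 / (Real.pi ^ 2 / 3 - 2) * ∑' l : ℕ+, linearTerm Z l ω) ^ 2)
      P P' := by
  refine ⟨?_, ae_summable_quadraticTerm hZ_law, ae_summable_linearTerm hZ_law, ?_⟩
  · filter_upwards [hB.ae_integrable_sq_div_weight, hB.continuous_paths] with ω hω hc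
    refine ⟨?_, ?_, ?_⟩
    · simpa only [mul_div_assoc] using hω.const_mul 6
    · exact (hc.integrable_of_hasCompactSupport (HasCompactSupport.of_compactSpace _)).const_mul 6
    · simpa only [mul_assoc] using (integrable_continuous_mul_logit hc).const_mul 6
  · have hZ_meas : ∀ m, AEMeasurable (Z m) P' := fun m => (hZ_law m).aemeasurable
    have hZ_map : P'.map (fun ω k => Z k ω)
        = Measure.infinitePi fun _ : ℕ+ => gaussianReal 0 1 := by
      rw [hZ_indep.map_fun_eq_infinitePi_map₀' hZ_meas]
      simp only [(hZ_law _).map_eq]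
    -- Both sequences have the same infinite product law, so the same functional `seriesLimit` of
    -- each has the same law; the left one is almost surely `limitV B`.
    have hid : IdentDistrib (fun ω k => legendreCoeff (B · ω) k) (fun ω k => Z k ω) P P' :=
      ⟨aemeasurable_pi_iff.2 hB.aemeasurable_legendreCoeff, aemeasurable_pi_iff.2 hZ_meas,
        hB.map_fun_legendreCoeff.trans hZ_map.symm⟩
    have hcomp := hid.comp_of_aemeasurable (u := seriesLimit)
      (hB.map_fun_legendreCoeff ▸ aemeasurable_seriesLimit)
    have hae : limitV B =ᵐ[P] seriesLimit ∘ fun ω k => legendreCoeff (B · ω) k := by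
      filter_upwards [hB.ae_integrable_sq_div_weight, hB.continuous_paths] with ω hω hc
      exact limitV_eq_seriesLimit hc hω
    exact (IdentDistrib.of_ae_eq (hcomp.aemeasurable_fst.congr hae.symm) hae).trans hcomp
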